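/- Let $K \subset \mathbb{C}$ be a quadratic extension of $\mathbb{Q}(\sqrt{2})$, that is, a subfield of $\mathbb{C}$ containing $\mathbb{Q}(\sqrt 2)$ with $[K : \mathbb{Q}(\sqrt{2})] = 2$, and let $P = (a:b:c)$ be a point of the Fermat quartic $a^4 + b^4 = c^4$ in the projective plane $\mathbb{P}^2(\mathbb{C})$ (with affine equation $x^4+y^4=1$, where $x=a/c$, $y=b/c$). Say that $P$ lies in a subfield $F$ of $\mathbb{C}$ if $P$ has homogeneous coordinates in $F$. If $P$ lies in $K$, then $P$ lies in at least one of the fields $$\mathbb{Q}(\sqrt{2}, i), \qquad \mathbb{Q}(\sqrt{2}, \sqrt{-7}), \qquad \mathbb{Q}(\sqrt[4]{2}), \qquad \mathbb{Q}(\sqrt[4]{2}\, i),$$ where $\sqrt[4]{2}$ denotes the positive real fourth root of $2$. -/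

import Mathlib

open scoped LinearAlgebra.Projectivization

namespace FermatQuartic

/-- The Fermat quartic `a ^ 4 + b ^ 4 = c ^ 4`, as a set of points `(a : b : c)` of the complex
projective plane. The equation is homogeneous, so the chosen representative does not matter
(see `mk_mem_curve`). -/
def curve : Set (ℙ ℂ (Fin 3 → ℂ)) :=
  {P | P.rep 0 ^ 4 + P.rep 1 ^ 4 = P.rep 2 ^ 4}

theorem mk_mem_curve (v : Fin 3 → ℂ) (hv : v ≠ 0) :
    Projectivization.mk ℂ v hv ∈ curve ↔ v 0 ^ 4 + v 1 ^ 4 = v 2 ^ 4 := by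
  obtain ⟨a, ha⟩ := Projectivization.exists_smul_eq_mk_rep ℂ v hv
  have ha0 : (a : ℂ) ^ 4 ≠ 0 := pow_ne_zero 4 a.ne_zero
  unfold curve
  rw [Set.mem_ofPred_eq, ← ha]
  simp only [Pi.smul_apply, Units.smul_def, smul_eq_mul, mul_pow]
  rw [← mul_add, mul_right_inj' ha0]

/-- A point of the complex projective plane lies in (is rational over) the subfield `F` of `ℂ`
if it has homogeneous coordinates in `F`. -/
def LiesIn (P : ℙ ℂ (Fin 3 → ℂ)) (F : Subfield ℂ) : Prop :=
  ∃ (v : Fin 3 → ℂ) (hv : v ≠ 0), (∀ i, v i ∈ F) ∧ P = Projectivization.mk ℂ v hv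

/-- The real square root of two, as a complex number. -/
noncomputable def sqrtTwo : ℂ := ((√2 : ℝ) : ℂ)

/-- The positive real fourth root of two, as a complex number. -/
noncomputable def fourthRootTwo : ℂ := (((2 : ℝ) ^ (1 / 4 : ℝ) : ℝ) : ℂ)

/-- The square root of `-7` in the upper half plane. -/
noncomputable def sqrtNegSeven : ℂ := ((√7 : ℝ) : ℂ) * Complex.I

/-- The field `ℚ(√2)`, inside `ℂ`. -/
noncomputable abbrev QSqrtTwo : IntermediateField ℚ ℂ :=
  IntermediateField.adjoin ℚ {sqrtTwo}

end FermatQuartic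

/-! Write k = ℚ(√2). If K contains a square root of -1, -7, √2 or -√2, that root is not in k, so it
generates K over k and K is contained in one of the four fields (`toSubfield_le`). Otherwise P is
already defined over k, which is contained in all four.

The second claim rests on the elliptic curve E : Y² = X³ + 4X. By Fermat descent, E and its twist by
2 have very few rational points, and E gains no new X-coordinate over k: only 0 and 2 occur
(`eq_zero_or_eq_two`). The quartic maps to E by g = (1 + x²)/y², (X, Y) = (2g, 4g/y). If g ∈ k, then
x² and y² lie in k, and quotient curves of the quartic over k settle the matter
(`mem_range_of_sq_mem_range`). If g ∉ k, the chord through the image point and its conjugate meets E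
in a third point, defined over k, hence with X = 0 or X = 2 (`exists_chord`). When x and y are both
outside k, X = 0 is impossible, and X = 2 puts the point on a conic over k with one parameter p
(`exists_conic`). Exchanging x and y gives a second conic with parameter q. Together they leave
finitely many (p, q) (`conic_relations`), and each one forces x or y into k, or a square root of -1,
-3 or -7. -/

namespace FermatQuartic

/-! ### Fermat descent for x⁴ = y⁴ + z² -/

/-- Fermat: a difference of two coprime fourth powers is a square only trivially. -/
theorem eq_zero_of_pow_four_eq_pow_four_add_sq_of_coprime (N : ℕ) :
    ∀ x y z : ℤ, x.natAbs = N → IsCoprime x y → x ^ 4 = y ^ 4 + z ^ 2 → y = 0 ∨ z = 0 := by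
  induction N using Nat.strong_induction_on with
  | _ N ih =>
  intro x y z hxN hxy h
  by_contra! hyz
  obtain ⟨hy, hz⟩ := hyz
  have hx : x ≠ 0 := by
    rintro rfl
    have := sq_nonneg (y ^ 2)
    have : 0 < z ^ 2 := by positivity
    nlinarith
  have hyz : IsCoprime (y ^ 2) z := by
    have h1 : IsCoprime y (z ^ 2 + y * y ^ 3) := by
      have : z ^ 2 + y * y ^ 3 = x ^ 4 := by rw [h]; ring
      rw [this]
      exact hxy.symm.pow_right
    exact ((IsCoprime.of_add_mul_left_right h1).of_isCoprime_of_dvd_right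
      (dvd_pow_self z two_ne_zero)).pow_left
  have hpt : PythagoreanTriple z (y ^ 2) (x ^ 2) := by
    unfold PythagoreanTriple; linear_combination -h
  have hx2 : 0 < x ^ 2 := by positivity
  rcases Int.emod_two_eq_zero_or_one z with hz2 | hz2
  · have hy2 : y ^ 2 % 2 = 1 := by
      rcases Int.emod_two_eq_zero_or_one (y ^ 2) with hy2 | hy2
      · have := hyz.isUnit_of_dvd' (Int.dvd_of_emod_eq_zero hy2) (Int.dvd_of_emod_eq_zero hz2)
        rw [Int.isUnit_iff] at this; omega
      · exact hy2
    obtain ⟨m, n, h1, h2, h3, h4, -, h6⟩ := hpt.symm.coprime_classification'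
      (Int.isCoprime_iff_gcd_eq_one.1 hyz) hy2 hx2
    have hn : n ≠ 0 := by rintro rfl; simp at h2; exact hz h2
    have hlt : m.natAbs < N := by
      rw [← hxN]
      apply Int.natAbs_lt_iff_sq_lt.2
      have : 0 < n ^ 2 := by positivity
      linarith
    -- Here x² = m² + n² and y² = m² - n², so (xy)² = m⁴ - n⁴ with |m| < |x|.
    rcases ih _ hlt m n (x * y) rfl (Int.isCoprime_iff_gcd_eq_one.2 h4) (by
      rw [mul_pow, h1, h3]; ring) with h | h
    · exact hn h
    · exact mul_ne_zero hx hy h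
  · obtain ⟨m, n, -, h2, h3, h4, h5, h6⟩ := hpt.coprime_classification'
      (Int.isCoprime_iff_gcd_eq_one.1 hyz.symm) hz2 hx2
    obtain ⟨e, o, hyeo, hxeo, hco, ho⟩ : ∃ e o : ℤ, y ^ 2 = 4 * (e * o) ∧
        x ^ 2 = 4 * e ^ 2 + o ^ 2 ∧ IsCoprime e o ∧ o % 2 = 1 := by
      have hmn := Int.isCoprime_iff_gcd_eq_one.2 h4
      rcases h5 with ⟨hm, hn⟩ | ⟨hm, hn⟩
      · obtain ⟨e, rfl⟩ := Int.dvd_of_emod_eq_zero hm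
        exact ⟨e, n, by rw [h2]; ring, by rw [h3]; ring, hmn.of_mul_left_right, hn⟩
      · obtain ⟨e, rfl⟩ := Int.dvd_of_emod_eq_zero hn
        exact ⟨e, m, by rw [h2]; ring, by rw [h3]; ring, hmn.symm.of_mul_left_right, hm⟩
    obtain ⟨w, rfl⟩ : Even y := by
      have : Even (y ^ 2) := by rw [hyeo]; exact ⟨2 * (e * o), by ring⟩
      exact (Int.even_pow.1 this).1
    have hw : e * o = w ^ 2 := by linarith [show (w + w) ^ 2 = 4 * w ^ 2 by ring]
    have hw0 : w ≠ 0 := by rintro rfl; simp at hy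
    obtain ⟨r, hr⟩ : ∃ r, e ^ 2 = r ^ 4 := by
      obtain ⟨r, hr⟩ := Int.sq_of_isCoprime hco hw
      exact ⟨r, by rcases hr with rfl | rfl <;> ring⟩
    obtain ⟨s, hs⟩ : ∃ s, o ^ 2 = s ^ 4 := by
      obtain ⟨s, hs⟩ := Int.sq_of_isCoprime hco.symm (by rw [mul_comm]; exact hw)
      exact ⟨s, by rcases hs with rfl | rfl <;> ring⟩
    have he0 : e ≠ 0 := by rintro rfl; simp at hw; exact hw0 (pow_eq_zero_iff two_ne_zero |>.1 hw.symm)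
    have hrs : IsCoprime (s ^ 2) (2 * r ^ 2) := by
      have h1 : IsCoprime (s ^ 4) (r ^ 4) := by rw [← hr, ← hs]; exact hco.symm.pow
      have h2 : IsCoprime (s ^ 2) (r ^ 2) :=
        (h1.of_isCoprime_of_dvd_left ⟨s ^ 2, by ring⟩).of_isCoprime_of_dvd_right ⟨r ^ 2, by ring⟩
      refine IsCoprime.mul_right ?_ h2
      have h3 : IsCoprime (s ^ 4) 2 := by
        rw [← hs]
        refine IsCoprime.pow_left ⟨1, -(o / 2), ?_⟩
        omega
      exact h3.of_isCoprime_of_dvd_left ⟨s ^ 2, by ring⟩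
    have hso : s ^ 2 % 2 = 1 := by
      have : Odd (s ^ 2) := by
        have h1 : Odd (s ^ 4) := by rw [← hs]; exact (Int.odd_iff.2 ho).pow
        rw [show s ^ 4 = s ^ 2 * s ^ 2 by ring] at h1
        exact (Int.odd_mul.1 h1).1
      exact Int.odd_iff.1 this
    -- As e and o are squares up to sign, x² = s⁴ + 4r⁴ is a second Pythagorean triple. Its
    -- parameters a and b have product r², so they are ±A² and ±B², and s² = A⁴ - B⁴ is a smaller
    -- solution.
    have hpt' : PythagoreanTriple (s ^ 2) (2 * r ^ 2) |x| := by
      unfold PythagoreanTriple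
      rw [abs_mul_abs_self, ← pow_two x, hxeo, hr, hs]; ring
    obtain ⟨a, b, g1, g2, g3, g4, -, ha⟩ := hpt'.coprime_classification'
      (Int.isCoprime_iff_gcd_eq_one.1 hrs) hso (abs_pos.2 hx)
    have hab : a * b = r ^ 2 := by linarith
    have hr0 : r ≠ 0 := by rintro rfl; simp at hr; exact he0 hr
    have hs0 : s ≠ 0 := by rintro rfl; simp at hso
    have ha0 : a ≠ 0 := by rintro rfl; simp at hab; exact hr0 (pow_eq_zero_iff two_ne_zero |>.1 hab.symm)
    have hb0 : b ≠ 0 := by rintro rfl; simp at hab; exact hr0 (pow_eq_zero_iff two_ne_zero |>.1 hab.symm)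
    have hcab := Int.isCoprime_iff_gcd_eq_one.2 g4
    obtain ⟨A, hA⟩ : ∃ A, a ^ 2 = A ^ 4 := by
      obtain ⟨r, hr⟩ := Int.sq_of_isCoprime hcab hab
      exact ⟨r, by rcases hr with rfl | rfl <;> ring⟩
    obtain ⟨B, hB⟩ : ∃ B, b ^ 2 = B ^ 4 := by
      obtain ⟨s, hs⟩ := Int.sq_of_isCoprime hcab.symm (by rw [mul_comm]; exact hab)
      exact ⟨s, by rcases hs with rfl | rfl <;> ring⟩
    have hAB : IsCoprime A B := by
      have h1 : IsCoprime (A ^ 4) (B ^ 4) := by rw [← hA, ← hB]; exact hcab.pow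
      exact (IsCoprime.pow_iff (by norm_num) (by norm_num)).1 h1
    have hlt : A.natAbs < N := by
      rw [← hxN]
      apply Int.natAbs_lt_iff_sq_lt.2
      rw [← sq_abs x, g3, hA, hB]
      have hB0 : B ≠ 0 := by rintro rfl; simp at hB; exact hb0 hB
      have hA0 : A ≠ 0 := by rintro rfl; simp at hA; exact ha0 hA
      have h1 : 1 ≤ A ^ 2 := by have : 0 < A ^ 2 := by positivity
                                linarith
      have h2 : 1 ≤ B ^ 4 := by have : 0 < B ^ 4 := by positivity
                                linarith
      nlinarith [mul_le_mul h1 h1 zero_le_one (by linarith)]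
    rcases ih _ hlt A B s rfl hAB (by rw [← hA, ← hB, g1]; ring) with h | h
    · subst h; simp at hB; exact hb0 hB
    · exact hs0 h

theorem eq_zero_of_pow_four_eq_pow_four_add_sq {x y z : ℤ} (h : x ^ 4 = y ^ 4 + z ^ 2) :
    y = 0 ∨ z = 0 := by
  rcases eq_or_ne y 0 with hy | hy
  · exact Or.inl hy
  obtain ⟨g, x', y', hg, hco, rfl, rfl⟩ : ∃ g x' y' : ℤ, g ≠ 0 ∧ IsCoprime x' y' ∧
      x = x' * g ∧ y = y' * g := by
    have hpos : 0 < Int.gcd x y := Int.gcd_pos_of_ne_zero_right _ hy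
    obtain ⟨x', y', hco, hx', hy'⟩ := Int.exists_gcd_one hpos
    exact ⟨_, x', y', by exact_mod_cast hpos.ne', Int.isCoprime_iff_gcd_eq_one.2 hco, hx', hy'⟩
  obtain ⟨w, rfl⟩ : g ^ 2 ∣ z := by
    rw [← Int.pow_dvd_pow_iff two_ne_zero]
    exact ⟨x' ^ 4 - y' ^ 4, by linear_combination -h⟩
  have h' : x' ^ 4 = y' ^ 4 + w ^ 2 := by
    have : g ^ 4 ≠ 0 := pow_ne_zero _ hg
    apply mul_left_cancel₀ this
    linear_combination h
  rcases eq_zero_of_pow_four_eq_pow_four_add_sq_of_coprime _ _ _ _ rfl hco h' with h | h <;>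
    simp [h]

theorem exists_common_denominator (x y z : ℚ) : ∃ D : ℤ, D ≠ 0 ∧ ∃ X Y Z : ℤ,
    (X : ℚ) = x * D ∧ (Y : ℚ) = y * D ∧ (Z : ℚ) = z * D := by
  refine ⟨x.den * y.den * z.den, by simp, x.num * (y.den * z.den), y.num * (x.den * z.den),
    z.num * (x.den * y.den), ?_, ?_, ?_⟩
  · have := x.mul_den_eq_num; push_cast; linear_combination -(y.den * z.den : ℚ) * this
  · have := y.mul_den_eq_num; push_cast; linear_combination -(x.den * z.den : ℚ) * this
  · have := z.mul_den_eq_num; push_cast; linear_combination -(x.den * y.den : ℚ) * this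

theorem rat_eq_zero_of_pow_four_eq_pow_four_add_sq {x y z : ℚ} (h : x ^ 4 = y ^ 4 + z ^ 2) :
    y = 0 ∨ z = 0 := by
  obtain ⟨D, hD, X, Y, Z, hX, hY, hZ⟩ := exists_common_denominator x y z
  have hD' : (D : ℚ) ≠ 0 := by exact_mod_cast hD
  have key : X ^ 4 = Y ^ 4 + (Z * D) ^ 2 := by
    have : (X : ℚ) ^ 4 = Y ^ 4 + (Z * D) ^ 2 := by
      rw [hX, hY, hZ]; linear_combination (D : ℚ) ^ 4 * h
    exact_mod_cast this
  rcases eq_zero_of_pow_four_eq_pow_four_add_sq key with h | h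
  · left; rw [h] at hY; simpa [hD'] using hY.symm
  · right
    rcases mul_eq_zero.1 h with h | h
    · rw [h] at hZ; simpa [hD'] using hZ.symm
    · exact absurd h hD

theorem rat_eq_zero_of_pow_four_add_pow_four_eq_sq {x y z : ℚ} (h : x ^ 4 + y ^ 4 = z ^ 2) :
    x = 0 ∨ y = 0 := by
  obtain ⟨D, hD, X, Y, Z, hX, hY, hZ⟩ := exists_common_denominator x y z
  have hD' : (D : ℚ) ≠ 0 := by exact_mod_cast hD
  have key : X ^ 4 + Y ^ 4 = (Z * D) ^ 2 := by
    have : (X : ℚ) ^ 4 + Y ^ 4 = (Z * D) ^ 2 := by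
      rw [hX, hY, hZ]; linear_combination (D : ℚ) ^ 4 * h
    exact_mod_cast this
  by_contra! hne
  refine not_fermat_42 ?_ ?_ key
  · rintro rfl; simp [hD', hne.1] at hX
  · rintro rfl; simp [hD', hne.2] at hY

/-! ### Rational points on E, on its twist by 2, and on two auxiliary quartics -/

/-- Dividing by X² gives (Y/X)² = X + 4/X, and (X + 4/X)² = 16 + (X - 4/X)² is a case of Fermat's
equation. -/
theorem rat_eq_zero_or_eq_two {X Y : ℚ} (h : Y ^ 2 = X ^ 3 + 4 * X) : X = 0 ∨ X = 2 := by
  rcases eq_or_ne X 0 with hX | hX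
  · exact Or.inl hX
  right
  have h1 : (Y / X) ^ 4 = 2 ^ 4 + (X - 4 / X) ^ 2 := by
    have : (Y / X) ^ 4 = (X ^ 3 + 4 * X) ^ 2 / X ^ 4 := by rw [← h]; ring
    rw [this]; field_simp; ring
  have h2 := (rat_eq_zero_of_pow_four_eq_pow_four_add_sq h1).resolve_left two_ne_zero
  have h3 : (X - 2) * (X + 2) = 0 := by field_simp at h2; linear_combination h2
  rcases mul_eq_zero.1 h3 with h3 | h3
  · linarith
  · nlinarith [sq_nonneg Y, show X = -2 by linarith]

theorem rat_sq_ne_two (x : ℚ) : x ^ 2 ≠ 2 := by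
  intro h
  apply irrational_sqrt_two
  refine ⟨|x|, ?_⟩
  rw [eq_comm, Real.sqrt_eq_iff_mul_self_eq (by norm_num) (by positivity)]
  have : (x : ℝ) ^ 2 = 2 := by exact_mod_cast h
  push_cast
  rw [abs_mul_abs_self]; linarith

/-- The same division leads to m⁴ = 4 + n², and (m⁴ - 4)² + 16m⁴ = (m⁴ + 4)² turns this into a sum
of two fourth powers equal to a square. -/
theorem rat_eq_zero_of_two_mul_sq {X Y : ℚ} (h : 2 * Y ^ 2 = X ^ 3 + 4 * X) : X = 0 := by
  by_contra hX
  have h1 : (Y / X) ^ 4 = 4 + ((X - 4 / X) / 2) ^ 2 := by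
    have : (Y / X) ^ 4 = (X ^ 3 + 4 * X) ^ 2 / X ^ 4 / 4 := by rw [← h]; ring
    rw [this]; field_simp; ring
  generalize Y / X = m at h1
  generalize (X - 4 / X) / 2 = n at h1
  have h2 : n ^ 4 + (2 * m) ^ 4 = (m ^ 4 + 4) ^ 2 := by
    linear_combination -(n ^ 2 + m ^ 4 - 4) * h1
  rcases rat_eq_zero_of_pow_four_add_pow_four_eq_sq h2 with h | h
  · rw [h] at h1
    have h3 : (m ^ 2 - 2) * (m ^ 2 + 2) = 0 := by linear_combination h1
    rcases mul_eq_zero.1 h3 with h3 | h3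
    · exact rat_sq_ne_two m (by linarith)
    · nlinarith [sq_nonneg m]
  · have hm : m = 0 := by linarith
    rw [hm] at h1
    nlinarith [sq_nonneg n]

/-- Scale (m⁴ - 16)² + 64m⁴ = (m⁴ + 16)² by 1/1024, with m⁴ - 16 = 2s². -/
theorem rat_eq_zero_of_pow_four_sub_sixteen {m s : ℚ} (h : m ^ 4 - 16 = 2 * s ^ 2) : s = 0 := by
  have h2 : (s / 4) ^ 4 + (m / 2) ^ 4 = (((m / 2) ^ 4 + 1) / 2) ^ 2 := by
    linear_combination (-(m ^ 4) / 1024 + s ^ 2 * (-1 / 512) + 1 / 64) * h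
  rcases rat_eq_zero_of_pow_four_add_pow_four_eq_sq h2 with h3 | h3
  · linarith
  · have hm : m = 0 := by linarith
    rw [hm] at h
    nlinarith [sq_nonneg s]

/-- The obstruction is 2-adic: at coprime (M, D) the homogenized quartic is odd (M odd) or four
times an odd number (M even), so its valuation is even, while that of twice a square is odd. -/
theorem rat_quartic_ne_two_mul_sq (m s : ℚ) :
    m ^ 4 - 12 * m ^ 2 + 32 * m - 28 ≠ 2 * s ^ 2 := by
  intro h
  obtain ⟨M, D, hMD, hD, rfl⟩ : ∃ M D : ℤ, IsCoprime M D ∧ D ≠ 0 ∧ m = M / D :=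
    ⟨m.num, m.den, Rat.isCoprime_num_den m, by simp, m.num_div_den.symm⟩
  have hD' : (D : ℚ) ≠ 0 := by exact_mod_cast hD
  obtain ⟨u, v, huv, hv, hu⟩ : ∃ u v : ℤ, IsCoprime u v ∧ v ≠ 0 ∧ s * D ^ 2 = u / v :=
    ⟨(s * D ^ 2).num, (s * D ^ 2).den, Rat.isCoprime_num_den _, by simp,
      (s * D ^ 2).num_div_den.symm⟩
  have hv' : (v : ℚ) ≠ 0 := by exact_mod_cast hv
  have key : (M ^ 4 - 12 * M ^ 2 * D ^ 2 + 32 * M * D ^ 3 - 28 * D ^ 4) * v ^ 2 = 2 * u ^ 2 := by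
    have : ((M : ℚ) ^ 4 - 12 * M ^ 2 * D ^ 2 + 32 * M * D ^ 3 - 28 * D ^ 4) * v ^ 2 =
        2 * u ^ 2 := by
      have h1 : s * D ^ 2 * v = u := by rw [hu]; field_simp
      rw [← h1]
      field_simp at h
      linear_combination (v : ℚ) ^ 2 * h
    exact_mod_cast this
  have two_dvd {k a b : ℤ} (hk : Odd k) (h : k * a ^ 2 = 2 * b) : 2 ∣ a := by
    have h1 : Even (k * a ^ 2) := h ▸ even_two_mul b
    rcases Int.even_mul.1 h1 with h1 | h1
    · exact absurd h1 (Int.not_even_iff_odd.2 hk)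
    · exact (Int.even_pow.1 h1).1.two_dvd
  have not_unit {a b : ℤ} (h : IsCoprime a b) (ha : 2 ∣ a) (hb : 2 ∣ b) : False := by
    have := h.isUnit_of_dvd' ha hb
    rw [Int.isUnit_iff] at this; omega
  rcases Int.even_or_odd M with hM | hM
  · obtain ⟨M, rfl⟩ := hM.two_dvd
    have hDo : Odd D := by
      by_contra hD
      exact not_unit hMD ⟨M, rfl⟩ (Int.not_odd_iff_even.1 hD).two_dvd
    have hk : Odd (2 * (2 * M ^ 4 - 6 * M ^ 2 * D ^ 2 + 8 * M * D ^ 3 - 4 * D ^ 4) + D ^ 4) :=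
      (even_two_mul _).add_odd hDo.pow
    have hu2 : 2 ∣ u := two_dvd odd_one (b :=
      (4 * M ^ 4 - 12 * M ^ 2 * D ^ 2 + 16 * M * D ^ 3 - 7 * D ^ 4) * v ^ 2) (by linarith)
    obtain ⟨u, rfl⟩ := hu2
    exact not_unit huv ⟨u, rfl⟩ (two_dvd (b := u ^ 2) hk (by linarith))
  · have hk : Odd (M ^ 4 + 2 * (-6 * M ^ 2 * D ^ 2 + 16 * M * D ^ 3 - 14 * D ^ 4)) :=
      hM.pow.add_even (even_two_mul _)
    have hv2 : 2 ∣ v := two_dvd hk (b := u ^ 2) (by linarith)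
    obtain ⟨v, rfl⟩ := hv2
    refine not_unit huv (two_dvd odd_one (b :=
      (M ^ 4 - 12 * M ^ 2 * D ^ 2 + 32 * M * D ^ 3 - 28 * D ^ 4) * v ^ 2) (by linarith)) ⟨v, rfl⟩

/-! ### Chords through conjugate points, and E over ℚ(√2) -/

/-- Let `L = F(δ)` with `δ ^ 2 = d ∈ F`, and let `(X, Y)` be an `L`-point of `Y ^ 2 = X ^ 3 + 4 * X`
with `X = a + b * δ` outside `F`. The chord through `(X, Y)` and its conjugate is defined over `F`
and meets the curve in a third point, with coordinate `r = m ^ 2 - 2 * a`. -/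
theorem exists_chord {F L : Type*} [Field F] [Field L] [Algebra F L] {δ : L} {d : F}
    (hδ : δ ^ 2 = algebraMap F L d) (hind : δ ∉ Set.range (algebraMap F L))
    (hrep : ∀ z : L, ∃ a b : F, z = algebraMap F L a + algebraMap F L b * δ)
    {a b : F} {X Y : L} (hX : X = algebraMap F L a + algebraMap F L b * δ) (hb : b ≠ 0)
    (h : Y ^ 2 = X ^ 3 + 4 * X) :
    ∃ m n r : F, Y = algebraMap F L m * X + algebraMap F L n ∧ r = m ^ 2 - 2 * a ∧
      r ^ 3 + 4 * r = (m * r + n) ^ 2 ∧ a ^ 2 - d * b ^ 2 + r * (2 * a) = 4 - 2 * m * n ∧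
      r * (a ^ 2 - d * b ^ 2) = n ^ 2 := by
  obtain ⟨c, e, hY⟩ := hrep Y
  have hlin {A B : F} (h : algebraMap F L A * X + algebraMap F L B = 0) : A = 0 ∧ B = 0 := by
    have hA : A = 0 := by
      by_contra hA
      apply hind
      refine ⟨(-B / A - a) / b, ?_⟩
      have hA' : algebraMap F L A ≠ 0 := by simpa using hA
      have hb' : algebraMap F L b ≠ 0 := by simpa using hb
      rw [hX] at h
      simp only [map_div₀, map_sub, map_neg]
      field_simp
      linear_combination -h
    subst hA
    simpa using h
  have hb' : algebraMap F L b ≠ 0 := by simpa using hb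
  obtain ⟨m, n, hmn⟩ : ∃ m n : F, Y = algebraMap F L m * X + algebraMap F L n := by
    refine ⟨e / b, c - e / b * a, ?_⟩
    rw [hY, hX]
    simp only [map_div₀, map_sub, map_mul]
    field_simp
    ring
  have hq : X ^ 2 - algebraMap F L (2 * a) * X + algebraMap F L (a ^ 2 - d * b ^ 2) = 0 := by
    rw [hX]
    simp only [map_sub, map_mul, map_pow, ← hδ, map_ofNat]
    ring
  -- Substituting the line into E gives a cubic in X. Its remainder modulo the quadratic `hq` is
  -- linear in X, so both coefficients vanish because X ∉ F.
  obtain ⟨h1, h2⟩ : 4 - 2 * m * n - (a ^ 2 - d * b ^ 2) - (m ^ 2 - 2 * a) * (2 * a) = 0 ∧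
      (m ^ 2 - 2 * a) * (a ^ 2 - d * b ^ 2) - n ^ 2 = 0 := by
    apply hlin
    rw [hmn] at h
    simp only [map_sub, map_mul, map_pow, map_ofNat] at hq ⊢
    linear_combination -h - (X - (algebraMap F L m ^ 2 - 2 * algebraMap F L a)) * hq
  refine ⟨m, n, _, hmn, rfl, ?_, ?_, ?_⟩
  · linear_combination (m ^ 2 - 2 * a) * h1 + h2
  · linear_combination -h1
  · linear_combination h2

/-- The points of `Y ^ 2 = X ^ 3 + 4 * X` over `ℚ(√2)`. -/
theorem eq_zero_or_eq_two {k : Type*} [Field k] [CharZero k] {s : k} (hs : s ^ 2 = 2)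
    (hrep : ∀ z : k, ∃ a b : ℚ, z = a + b * s) {X Y : k} (h : Y ^ 2 = X ^ 3 + 4 * X) :
    X = 0 ∨ X = 2 := by
  have hind : s ∉ Set.range (algebraMap ℚ k) := by
    rintro ⟨q, rfl⟩
    refine rat_sq_ne_two q ?_
    have : (q : k) ^ 2 = 2 := by simpa using hs
    exact_mod_cast this
  obtain ⟨a, b, hX⟩ := hrep X
  rcases eq_or_ne b 0 with rfl | hb
  · have hX' : X = (a : k) := by simpa using hX
    obtain ⟨c, e, hY⟩ := hrep Y
    have h1 : ((c ^ 2 + 2 * e ^ 2 : ℚ) : k) + ((2 * c * e : ℚ) : k) * s = ((a ^ 3 + 4 * a : ℚ) : k) := by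
      rw [hY, hX'] at h
      push_cast
      linear_combination h - (e : k) ^ 2 * hs
    have hce : c * e = 0 := by
      by_contra hce
      apply hind
      refine ⟨(a ^ 3 + 4 * a - (c ^ 2 + 2 * e ^ 2)) / (2 * (c * e)), ?_⟩
      have hc' : (c : k) ≠ 0 := by exact_mod_cast left_ne_zero_of_mul hce
      have he' : (e : k) ≠ 0 := by exact_mod_cast right_ne_zero_of_mul hce
      push_cast at h1
      simp only [eq_ratCast]
      push_cast
      field_simp
      linear_combination -h1
    have h2 : c ^ 2 + 2 * e ^ 2 = a ^ 3 + 4 * a := by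
      rw [mul_assoc, hce] at h1
      simp only [mul_zero, Rat.cast_zero, zero_mul, add_zero] at h1
      exact_mod_cast h1
    rw [hX']
    -- If c = 0, then Y = e√2 and (a, e) lies on the twist 2Y² = X³ + 4X; if e = 0, the point is
    -- rational.
    rcases mul_eq_zero.1 hce with rfl | rfl
    · left
      rw [rat_eq_zero_of_two_mul_sq (X := a) (Y := e) (by linear_combination h2), Rat.cast_zero]
    · rcases rat_eq_zero_or_eq_two (X := a) (Y := c) (by linear_combination h2) with rfl | rfl
      · left; simp
      · right; simp
  · exfalso
    obtain ⟨m, n, r, -, hr, h1, h2, h3⟩ := exists_chord (F := ℚ) (d := 2) (δ := s) (by simpa using hs) hind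
      (by simpa using hrep) (by simpa using hX) hb h
    -- For each value of r, the discriminant 8b² = 2(2b)² of the quadratic for X over ℚ becomes a
    -- quartic in m, covered by the two auxiliary lemmas.
    rcases rat_eq_zero_or_eq_two h1.symm with hr0 | hr0 <;> rw [hr0] at h1 h2 h3 hr
    · have hn : n = 0 := by simpa using h3.symm
      subst hn
      have := rat_eq_zero_of_pow_four_sub_sixteen (m := m) (s := 2 * b) (by
        linear_combination -(m ^ 2 + 2 * a) * hr + 4 * h2)
      exact hb (by linarith)
    · have h4 : (2 * m + n - 4) * (2 * m + n + 4) = 0 := by linear_combination -h1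
      rcases mul_eq_zero.1 h4 with h4 | h4
      · have hn : n = 4 - 2 * m := by linarith
        subst hn
        apply rat_quartic_ne_two_mul_sq m (2 * b)
        linear_combination -(m ^ 2 + 6 + 2 * a) * hr + 4 * h2
      · have hn : n = -4 - 2 * m := by linarith
        subst hn
        apply rat_quartic_ne_two_mul_sq (-m) (2 * b)
        linear_combination -(m ^ 2 + 6 + 2 * a) * hr + 4 * h2

/-! ### Points of the quartic over a quadratic extension L = k(δ) -/

section QuadraticExtension

variable {k L : Type*} [Field k] [Field L] [Algebra k L]

/-- The curve maps to E by X = 2(1 + v)/x², Y = 4(1 + v)/x³. -/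
theorem eq_zero_or_pow_four_eq_one (hk : ∀ X Y : k, Y ^ 2 = X ^ 3 + 4 * X → X = 0 ∨ X = 2)
    (h2 : (2 : k) ≠ 0) {x v : k} (h : x ^ 4 + v ^ 2 = 1) : x = 0 ∨ x ^ 4 = 1 := by
  rcases eq_or_ne x 0 with hx | hx
  · exact Or.inl hx
  right
  have h4 : (x ^ 4 : k) = (1 - v) * (1 + v) := by linear_combination h
  rcases hk (2 * (1 + v) / x ^ 2) (4 * (1 + v) / x ^ 3) (by
    field_simp
    linear_combination (-8) * (1 + v) * h4) with hX | hX
  · have hv : 1 + v = 0 := by simpa [h2, hx] using hX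
    rw [hv, mul_zero] at h4
    exact absurd h4 (pow_ne_zero 4 hx)
  · have hv : 1 + v = x ^ 2 := by
      field_simp at hX
      exact hX
    have hx2 : x ^ 2 ≠ 0 := pow_ne_zero 2 hx
    have : 1 - v = x ^ 2 := by
      apply mul_right_cancel₀ hx2
      rw [← hv, ← h4, hv]; ring
    have hv0 : 2 * v = 0 := by linear_combination hv - this
    have hv0 : v = 0 := by simpa [h2] using hv0
    rw [hv0] at h4
    linear_combination h4

/-- The curve maps to E by X = 2z², Y = 2szw; this is where √2 ∈ k is needed. -/
theorem eq_zero_or_sq_eq_one (hk : ∀ X Y : k, Y ^ 2 = X ^ 3 + 4 * X → X = 0 ∨ X = 2)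
    (h2 : (2 : k) ≠ 0) {s : k} (hs : s ^ 2 = 2) {z w : k} (h : w ^ 2 = 1 + z ^ 4) :
    z = 0 ∨ z ^ 2 = 1 := by
  rcases hk (2 * z ^ 2) (2 * s * z * w) (by
    linear_combination (4 * z ^ 2 * w ^ 2) * hs + 8 * z ^ 2 * h) with hX | hX
  · left; simpa [h2] using hX
  · right
    exact mul_left_cancel₀ h2 (by linear_combination hX)

variable {δ : L} {d : k}

theorem coeff_eq_zero (hind : δ ∉ Set.range (algebraMap k L)) {a b : k}
    (h : algebraMap k L a + algebraMap k L b * δ ∈ Set.range (algebraMap k L)) : b = 0 := by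
  by_contra hb
  obtain ⟨c, hc⟩ := h
  refine hind ⟨(c - a) / b, ?_⟩
  have hb' : algebraMap k L b ≠ 0 := by simpa using hb
  simp only [map_div₀, map_sub]
  field_simp
  linear_combination hc

theorem exists_mul_of_sq_mem (h2 : (2 : k) ≠ 0) (hδ : δ ^ 2 = algebraMap k L d)
    (hind : δ ∉ Set.range (algebraMap k L))
    (hrep : ∀ z : L, ∃ a b : k, z = algebraMap k L a + algebraMap k L b * δ) {x : L}
    (hx : x ∉ Set.range (algebraMap k L)) (hx2 : x ^ 2 ∈ Set.range (algebraMap k L)) :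
    ∃ b : k, b ≠ 0 ∧ x = algebraMap k L b * δ := by
  obtain ⟨a, b, rfl⟩ := hrep x
  have h : (algebraMap k L a + algebraMap k L b * δ) ^ 2 =
      algebraMap k L (a ^ 2 + b ^ 2 * d) + algebraMap k L (2 * a * b) * δ := by
    simp only [map_add, map_mul, map_pow, map_ofNat, ← hδ]
    ring
  rw [h] at hx2
  have hab := coeff_eq_zero hind hx2
  have hb : b ≠ 0 := by
    rintro rfl
    exact hx ⟨a, by simp⟩
  have ha : a = 0 := by simpa [h2, hb] using hab
  exact ⟨b, hb, by simp [ha]⟩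

theorem mem_range_of_sq_mem_range (hk : ∀ X Y : k, Y ^ 2 = X ^ 3 + 4 * X → X = 0 ∨ X = 2)
    (h2 : (2 : k) ≠ 0) {s : k} (hs : s ^ 2 = 2) (hδ : δ ^ 2 = algebraMap k L d)
    (hind : δ ∉ Set.range (algebraMap k L))
    (hrep : ∀ z : L, ∃ a b : k, z = algebraMap k L a + algebraMap k L b * δ)
    (hI : ∀ θ : L, θ ^ 2 ≠ -1)
    (hr : ∀ θ : L, θ ^ 2 ≠ algebraMap k L s) (hr' : ∀ θ : L, θ ^ 2 ≠ -algebraMap k L s)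
    {x y : L} (h : x ^ 4 + y ^ 4 = 1) (hx : x ^ 2 ∈ Set.range (algebraMap k L))
    (hy : y ^ 2 ∈ Set.range (algebraMap k L)) : x ∈ Set.range (algebraMap k L) := by
  have one_side {x y : L} (h : x ^ 4 + y ^ 4 = 1) (hx : x ∈ Set.range (algebraMap k L))
      (hy : y ^ 2 ∈ Set.range (algebraMap k L)) : y ∈ Set.range (algebraMap k L) := by
    obtain ⟨a, rfl⟩ := hx
    obtain ⟨v, hv⟩ := hy
    have h' : a ^ 4 + v ^ 2 = 1 := by
      apply (algebraMap k L).injective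
      simp only [map_add, map_pow, map_one, hv]
      linear_combination h
    rcases eq_zero_or_pow_four_eq_one hk h2 h' with ha | ha
    · subst ha
      have : (y - 1) * (y + 1) * (y ^ 2 + 1) = 0 := by simp at h; linear_combination h
      rcases mul_eq_zero.1 this with h1 | h1
      · rcases mul_eq_zero.1 h1 with h1 | h1
        · exact ⟨1, by rw [map_one]; linear_combination -h1⟩
        · exact ⟨-1, by rw [map_neg, map_one]; linear_combination -h1⟩
      · exact absurd (by linear_combination h1) (hI y)
    · have : y ^ 4 = 0 := by
        rw [← map_pow, ha, map_one] at h
        linear_combination h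
      exact ⟨0, by rw [map_zero, (pow_eq_zero_iff four_ne_zero).1 this]⟩
  by_contra hxn
  have hyn : y ∉ Set.range (algebraMap k L) := fun hyn =>
    hxn (one_side (by linear_combination h) hyn hx)
  obtain ⟨a, ha, rfl⟩ := exists_mul_of_sq_mem h2 hδ hind hrep hxn hx
  obtain ⟨b, hb, rfl⟩ := exists_mul_of_sq_mem h2 hδ hind hrep hyn hy
  have hd : d ≠ 0 := by
    rintro rfl
    apply hind
    exact ⟨0, by rw [map_zero, eq_comm, ← sq_eq_zero_iff, hδ, map_zero]⟩
  have h' : (a ^ 4 + b ^ 4) * d ^ 2 = 1 := by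
    apply (algebraMap k L).injective
    simp only [map_add, map_mul, map_pow, map_one, ← hδ]
    linear_combination h
  have hw : (1 / (a ^ 2 * d)) ^ 2 = 1 + (b / a) ^ 4 := by
    field_simp
    linear_combination -h'
  rcases eq_zero_or_sq_eq_one hk h2 hs hw with hz | hz
  · simp [ha, hb] at hz
  · have hab : b ^ 2 = a ^ 2 := by
      field_simp at hz
      exact hz
    -- Now 2a⁴d² = 1, so 2a²d = ±s and (saδ)² = ±s, which `hr` and `hr'` exclude.
    have h1 : (2 * a ^ 2 * d - s) * (2 * a ^ 2 * d + s) = 0 := by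
      linear_combination 2 * h' - hs - 2 * d ^ 2 * (b ^ 2 + a ^ 2) * hab
    rcases mul_eq_zero.1 h1 with h1 | h1
    · apply hr (algebraMap k L (s * a) * δ)
      have : s ^ 2 * a ^ 2 * d = s := by linear_combination h1 + a ^ 2 * d * hs
      calc _ = algebraMap k L (s ^ 2 * a ^ 2 * d) := by
            simp only [map_mul, map_pow, ← hδ]; ring
        _ = _ := by rw [this]
    · apply hr' (algebraMap k L (s * a) * δ)
      have : s ^ 2 * a ^ 2 * d = -s := by linear_combination h1 + a ^ 2 * d * hs
      calc _ = algebraMap k L (s ^ 2 * a ^ 2 * d) := by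
            simp only [map_mul, map_pow, ← hδ]; ring
        _ = _ := by rw [this, map_neg]

/-- Otherwise x² is a pure multiple of δ; for x = p + qδ this says p² + q²d = 0, and qδ/p is a
square root of -1. -/
theorem sq_mem_range_of_pow_four_mem_range (h2 : (2 : k) ≠ 0) (hδ : δ ^ 2 = algebraMap k L d)
    (hind : δ ∉ Set.range (algebraMap k L))
    (hrep : ∀ z : L, ∃ a b : k, z = algebraMap k L a + algebraMap k L b * δ)
    (hI : ∀ θ : L, θ ^ 2 ≠ -1) {x : L} (hx : x ^ 4 ∈ Set.range (algebraMap k L)) :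
    x ^ 2 ∈ Set.range (algebraMap k L) := by
  by_contra hx2
  obtain ⟨b, hb, hxb⟩ := exists_mul_of_sq_mem h2 hδ hind hrep hx2
    (by convert hx using 1; ring)
  obtain ⟨p, q, rfl⟩ := hrep x
  have hpq : algebraMap k L (p ^ 2 + q ^ 2 * d) + algebraMap k L (2 * p * q - b) * δ = 0 := by
    simp only [map_add, map_sub, map_mul, map_pow, map_ofNat, ← hδ]
    linear_combination hxb
  have h1 : 2 * p * q - b = 0 := coeff_eq_zero hind ⟨0, by rw [hpq, map_zero]⟩
  rw [h1, map_zero, zero_mul, add_zero] at hpq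
  have h3 : p ^ 2 + q ^ 2 * d = 0 := (map_eq_zero (algebraMap k L)).1 hpq
  have hp : p ≠ 0 := by
    rintro rfl
    apply hb
    linear_combination -h1
  have hp' : algebraMap k L p ≠ 0 := by simpa using hp
  apply hI (algebraMap k L q * δ / algebraMap k L p)
  have h4 := congrArg (algebraMap k L) h3
  simp only [map_add, map_mul, map_pow, map_zero, ← hδ] at h4
  field_simp
  linear_combination h4

/-- The conic is the chord of E through the third point (2, ±4), rewritten in x and y; the sign of
y' is chosen so that this point is (2, 4). -/
theorem exists_conic (hk : ∀ X Y : k, Y ^ 2 = X ^ 3 + 4 * X → X = 0 ∨ X = 2)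
    (h2 : (2 : k) ≠ 0) {s : k} (hs : s ^ 2 = 2) (hδ : δ ^ 2 = algebraMap k L d)
    (hind : δ ∉ Set.range (algebraMap k L))
    (hrep : ∀ z : L, ∃ a b : k, z = algebraMap k L a + algebraMap k L b * δ)
    (hI : ∀ θ : L, θ ^ 2 ≠ -1)
    (hr : ∀ θ : L, θ ^ 2 ≠ algebraMap k L s) (hr' : ∀ θ : L, θ ^ 2 ≠ -algebraMap k L s)
    {x y : L} (h : x ^ 4 + y ^ 4 = 1) (hx : x ∉ Set.range (algebraMap k L))
    (hy : y ∉ Set.range (algebraMap k L)) :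
    ∃ p : k, ∃ y' : L, (y' = y ∨ y' = -y) ∧
      x ^ 2 = 1 - algebraMap k L p * y' + (algebraMap k L p - 1) * y' ^ 2 := by
  have h2' : (2 : L) ≠ 0 := by
    rw [← map_ofNat (algebraMap k L)]; simpa using h2
  have hy0 : y ≠ 0 := by
    rintro rfl
    exact hy ⟨0, map_zero _⟩
  have hu : 1 + x ^ 2 ≠ 0 := fun hu => hI x (by linear_combination hu)
  obtain ⟨g, hg⟩ : ∃ g : L, g = (1 + x ^ 2) / y ^ 2 := ⟨_, rfl⟩
  have hg0 : g ≠ 0 := by rw [hg]; positivity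
  have hg1 : g * y ^ 2 = 1 + x ^ 2 := by rw [hg]; field_simp
  have hg2 : (1 - x ^ 2) * g = y ^ 2 := by
    apply mul_right_cancel₀ (pow_ne_zero 2 hy0)
    linear_combination (1 - x ^ 2) * hg1 - h
  have hE : (4 * g / y) ^ 2 = (2 * g) ^ 3 + 4 * (2 * g) := by
    field_simp
    linear_combination (-8) * g * hg1 + 8 * hg2
  have hgk : g ∉ Set.range (algebraMap k L) := by
    rintro ⟨γ, rfl⟩
    have hγ : 1 + γ ^ 2 ≠ 0 := by
      intro hγ
      apply hI (algebraMap k L γ)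
      rw [← map_pow, ← map_one (algebraMap k L), ← map_neg]
      congr 1
      linear_combination hγ
    have hγ' : 1 + algebraMap k L γ ^ 2 ≠ 0 := by
      rw [← map_pow, ← map_one (algebraMap k L), ← map_add]
      exact (map_ne_zero (algebraMap k L)).2 hγ
    -- Solve the linear system γy² = 1 + x², γ(1 - x²) = y² for x².
    have hx2 : x ^ 2 = algebraMap k L ((γ ^ 2 - 1) / (1 + γ ^ 2)) := by
      simp only [map_div₀, map_sub, map_add, map_pow, map_one]
      field_simp
      linear_combination -algebraMap k L γ * hg2 - hg1
    apply hx
    refine mem_range_of_sq_mem_range hk h2 hs hδ hind hrep hI hr hr' h ⟨_, hx2.symm⟩ ?_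
    rw [← hg2, hx2]
    exact ⟨(1 - (γ ^ 2 - 1) / (1 + γ ^ 2)) * γ, by simp only [map_sub, map_mul, map_one]⟩
  obtain ⟨a, b, hab⟩ := hrep (2 * g)
  have hb : b ≠ 0 := by
    rintro rfl
    refine hgk ⟨a / 2, ?_⟩
    rw [map_div₀, map_ofNat]
    field_simp
    rw [map_zero] at hab
    linear_combination -hab
  obtain ⟨m, n, r, hmn, -, h1, -, h3⟩ := exists_chord hδ hind hrep hab hb hE
  have hmn' : (4 - 2 * algebraMap k L m * y) * g = algebraMap k L n * y := by
    field_simp at hmn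
    linear_combination hmn
  rcases hk _ _ h1.symm with rfl | rfl
  · exfalso
    have hn : n = 0 := by simpa using h3.symm
    subst hn
    have hm : 4 - 2 * algebraMap k L m * y = 0 := by simpa [hg0] using hmn'
    have hm0 : m ≠ 0 := by
      rintro rfl
      have : (2 : L) * 2 = 0 := by simp at hm; linear_combination hm
      simp [h2'] at this
    have hm0' : algebraMap k L m ≠ 0 := by simpa using hm0
    refine hy ⟨2 / m, ?_⟩
    rw [map_div₀, map_ofNat]
    field_simp
    apply mul_left_cancel₀ h2'
    linear_combination hm
  · obtain ⟨m', n', y', hy', h4, hy'2, hmn''⟩ : ∃ m' n' : k, ∃ y' : L, (y' = y ∨ y' = -y) ∧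
        n' = 4 - 2 * m' ∧ y' ^ 2 = y ^ 2 ∧
        (4 - 2 * algebraMap k L m' * y') * g = algebraMap k L n' * y' := by
      have h4 : (2 * m + n - 4) * (2 * m + n + 4) = 0 := by linear_combination -h1
      rcases mul_eq_zero.1 h4 with h4 | h4
      · exact ⟨m, n, y, Or.inl rfl, by linear_combination h4, rfl, hmn'⟩
      · refine ⟨-m, -n, -y, Or.inr rfl, by linear_combination -h4, by ring, ?_⟩
        rw [map_neg, map_neg]
        linear_combination hmn'
    have hy'k : y' ∉ Set.range (algebraMap k L) := by
      rcases hy' with rfl | rfl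
      · exact hy
      · rintro ⟨c, hc⟩
        exact hy ⟨-c, by rw [map_neg, hc, neg_neg]⟩
    have hy'0 : y' ≠ 0 := by
      rintro rfl
      exact hy'k ⟨0, map_zero _⟩
    subst h4
    simp only [map_sub, map_mul, map_ofNat] at hmn''
    have hm : 2 - m' ≠ 0 := by
      intro hm
      have hm' : algebraMap k L m' = 2 := by
        rw [← map_ofNat (algebraMap k L)]
        congr 1
        linear_combination -hm
      rw [hm'] at hmn''
      have h5 : (2 * 2) * ((1 - y') * g) = 0 := by linear_combination hmn''
      have h6 : 1 - y' = 0 := by simpa [h2', hg0] using h5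
      exact hy'k ⟨1, by rw [map_one]; linear_combination h6⟩
    have hm' : 2 - algebraMap k L m' ≠ 0 := by
      rw [← map_ofNat (algebraMap k L), ← map_sub]
      exact (map_ne_zero (algebraMap k L)).2 hm
    have h5 : (1 - x ^ 2) * (2 - algebraMap k L m') = y' * (2 - algebraMap k L m' * y') := by
      apply mul_left_cancel₀ h2'
      apply mul_right_cancel₀ hy'0
      linear_combination (x ^ 2 - 1) * hmn'' + (4 - 2 * algebraMap k L m' * y') * (hg2 - hy'2)
    refine ⟨2 / (2 - m'), y', hy', ?_⟩
    simp only [map_div₀, map_sub, map_ofNat]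
    field_simp
    linear_combination -h5

/-- The conic and the quartic share the points with y = 0 and y = 1; removing the factor y(y - 1)
after eliminating x leaves a quadratic. -/
theorem quadratic_of_conic {x y p : L} (h : x ^ 4 + y ^ 4 = 1)
    (hc : x ^ 2 = 1 - p * y + (p - 1) * y ^ 2) (hy0 : y ≠ 0) (hy1 : y ≠ 1) :
    (p ^ 2 - 2 * p + 2) * y ^ 2 = (p ^ 2 - 2) * y - 2 * p := by
  have hy1' : y - 1 ≠ 0 := sub_ne_zero.2 hy1
  apply mul_left_cancel₀ hy0
  apply mul_left_cancel₀ hy1'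
  linear_combination h - (x ^ 2 + (1 - p * y + (p - 1) * y ^ 2)) * hc

/-- Eliminating `y` from the two conics, the two coefficients of a linear relation in `x`. -/
theorem conic_relations (h2 : (2 : k) ≠ 0) {x y : L} {p q : k}
    (hx : x ∉ Set.range (algebraMap k L))
    (hxc : x ^ 2 = 1 - algebraMap k L p * y + (algebraMap k L p - 1) * y ^ 2)
    (hyc : y ^ 2 = 1 - algebraMap k L q * x + (algebraMap k L q - 1) * x ^ 2)
    (hyq : (algebraMap k L p ^ 2 - 2 * algebraMap k L p + 2) * y ^ 2 =
      (algebraMap k L p ^ 2 - 2) * y - 2 * algebraMap k L p)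
    (hxq : (algebraMap k L q ^ 2 - 2 * algebraMap k L q + 2) * x ^ 2 =
      (algebraMap k L q ^ 2 - 2) * x - 2 * algebraMap k L q) :
    (p + q - 2) * (p + q - p * q) = 0 ∧
      p ^ 2 * q ^ 2 - 2 * p * q ^ 2 - 2 * p ^ 2 * q + 2 * q ^ 2 + 4 * p = 0 := by
  have hlin {A B : k} (h : algebraMap k L A * x + algebraMap k L B = 0) : A = 0 ∧ B = 0 := by
    have hA : A = 0 := by
      by_contra hA
      have hA' : algebraMap k L A ≠ 0 := by simpa using hA
      refine hx ⟨-B / A, ?_⟩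
      rw [map_div₀, map_neg]
      field_simp
      linear_combination -h
    subst hA
    simpa using h
  obtain ⟨h3, h4⟩ : (p ^ 2 - 2) * (q ^ 2 - 2) - (q ^ 2 - 4 * q + 2) * (p ^ 2 - 4 * p + 2) = 0 ∧
      (q ^ 2 - 2) * (p ^ 2 - 4 * p + 2) + 2 * p ^ 2 * (q ^ 2 - 2 * q + 2) -
        (p ^ 2 - 2) * (q ^ 2 + 2) = 0 := by
    apply hlin
    simp only [map_sub, map_add, map_mul, map_pow, map_ofNat]
    generalize algebraMap k L p = p at *
    generalize algebraMap k L q = q at *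
    -- Modulo the quadratic for x, both y² and py become linear in x up to the factor q² - 2q + 2;
    -- inserting them into `hyq` gives the linear relation.
    have e1 : (q ^ 2 - 2 * q + 2) * y ^ 2 = (q ^ 2 - 4 * q + 2) * x - (q ^ 2 - 2) := by
      linear_combination (q ^ 2 - 2 * q + 2) * hyc + (q - 1) * hxq
    have e2 : (q ^ 2 - 2 * q + 2) * (p * y) =
        ((p - 1) * (q ^ 2 - 4 * q + 2) - (q ^ 2 - 2)) * x +
          (q ^ 2 + 2 - (p - 1) * (q ^ 2 - 2)) := by
      linear_combination (q ^ 2 - 2 * q + 2) * hxc - hxq + (p - 1) * e1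
    linear_combination (q ^ 2 - 2 * q + 2) * p * hyq - (p ^ 2 - 2 * p + 2) * p * e1 +
      (p ^ 2 - 2) * e2
  constructor
  · apply mul_left_cancel₀ (mul_ne_zero h2 h2)
    linear_combination -h3
  · apply mul_left_cancel₀ h2
    linear_combination h4

theorem mem_range_of_pow_four_add_pow_four_eq_one
    (hk : ∀ X Y : k, Y ^ 2 = X ^ 3 + 4 * X → X = 0 ∨ X = 2)
    (h2 : (2 : k) ≠ 0) {s : k} (hs : s ^ 2 = 2) (h3 : ∀ u : k, u ^ 2 ≠ -3)
    (hδ : δ ^ 2 = algebraMap k L d) (hind : δ ∉ Set.range (algebraMap k L))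
    (hrep : ∀ z : L, ∃ a b : k, z = algebraMap k L a + algebraMap k L b * δ)
    (hI : ∀ θ : L, θ ^ 2 ≠ -1) (h7 : ∀ θ : L, θ ^ 2 ≠ -7)
    (hr : ∀ θ : L, θ ^ 2 ≠ algebraMap k L s) (hr' : ∀ θ : L, θ ^ 2 ≠ -algebraMap k L s)
    {x y : L} (h : x ^ 4 + y ^ 4 = 1) : x ∈ Set.range (algebraMap k L) := by
  have h' : y ^ 4 + x ^ 4 = 1 := by rw [add_comm, h]
  have of_right {x y : L} (h : x ^ 4 + y ^ 4 = 1) (hy : y ∈ Set.range (algebraMap k L)) :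
      x ∈ Set.range (algebraMap k L) := by
    obtain ⟨c, rfl⟩ := hy
    refine mem_range_of_sq_mem_range hk h2 hs hδ hind hrep hI hr hr' h
      (sq_mem_range_of_pow_four_mem_range h2 hδ hind hrep hI ⟨1 - c ^ 4, ?_⟩)
      ⟨c ^ 2, by rw [map_pow]⟩
    rw [map_sub, map_one, map_pow]
    linear_combination -h
  by_contra hx
  have hy : y ∉ Set.range (algebraMap k L) := fun hy => hx (of_right h hy)
  obtain ⟨p, y', hy', hp⟩ := exists_conic hk h2 hs hδ hind hrep hI hr hr' h hx hy
  obtain ⟨q, x', hx', hq⟩ := exists_conic hk h2 hs hδ hind hrep hI hr hr' h' hy hx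
  have hneg {z z' : L} (hz : z ∉ Set.range (algebraMap k L)) (hz' : z' = z ∨ z' = -z) :
      z' ∉ Set.range (algebraMap k L) := by
    rcases hz' with rfl | rfl
    · exact hz
    · rintro ⟨c, hc⟩
      exact hz ⟨-c, by rw [map_neg, hc, neg_neg]⟩
  have hsq {z z' : L} (hz' : z' = z ∨ z' = -z) : z ^ 2 = z' ^ 2 := by
    rcases hz' with rfl | rfl <;> ring
  replace hx := hneg hx hx'
  replace hy := hneg hy hy'
  rw [hsq hx'] at hp
  rw [hsq hy'] at hq
  replace h : x' ^ 4 + y' ^ 4 = 1 := by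
    linear_combination h - (x ^ 2 + x' ^ 2) * hsq hx' - (y ^ 2 + y' ^ 2) * hsq hy'
  clear h'
  have ne {z : L} (hz : z ∉ Set.range (algebraMap k L)) : z ≠ 0 ∧ z ≠ 1 := by
    constructor
    · rintro rfl; exact hz ⟨0, map_zero _⟩
    · rintro rfl; exact hz ⟨1, map_one _⟩
  have hyq := quadratic_of_conic h hp (ne hy).1 (ne hy).2
  have hxq := quadratic_of_conic (add_comm (x' ^ 4) _ ▸ h) hq (ne hx).1 (ne hx).2
  obtain ⟨e1, e2⟩ := conic_relations h2 hx hp hq hyq hxq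
  obtain ⟨-, e3⟩ := conic_relations h2 hy hq hp hxq hyq
  have hI' (u : k) : u ^ 2 ≠ -1 := by
    intro hu
    apply hI (algebraMap k L u)
    rw [← map_pow, hu, map_neg, map_one]
  have case_two (hpq : p + q - 2 = 0) : False := by
    obtain rfl : p = 2 - q := by linear_combination hpq
    -- On p + q = 2 the second relation is a quadratic in (q - 1)², with roots -1 and -3.
    have e4 : ((q - 1) ^ 2 + 1) * ((q - 1) ^ 2 + 3) = 0 := by linear_combination e2
    rcases mul_eq_zero.1 e4 with e4 | e4
    · exact hI' (q - 1) (by linear_combination e4)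
    · exact h3 (q - 1) (by linear_combination e4)
  rcases mul_eq_zero.1 e1 with e1 | e1
  · exact case_two e1
  have e5 : 2 * ((q - p) * (p + q - 2)) = 0 := by linear_combination e2 - e3
  have e6 : (q - p) * (p + q - 2) = 0 := by simpa [h2] using e5
  rcases mul_eq_zero.1 e6 with e6 | e6
  swap
  · exact case_two e6
  obtain rfl : p = q := by linear_combination -e6
  have h2' : (2 : L) ≠ 0 := by
    rw [← map_ofNat (algebraMap k L)]
    exact (map_ne_zero (algebraMap k L)).2 h2
  have e7 : p * (2 - p) = 0 := by linear_combination e1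
  rcases mul_eq_zero.1 e7 with e7 | e7
  · subst e7
    rw [map_zero] at hxq
    have e8 : 2 * (x' * (x' + 1)) = 0 := by linear_combination hxq
    have e9 : x' * (x' + 1) = 0 := by simpa [h2'] using e8
    rcases mul_eq_zero.1 e9 with e9 | e9
    · exact (ne hx).1 e9
    · exact hx ⟨-1, by rw [map_neg, map_one]; linear_combination -e9⟩
  · obtain rfl : p = 2 := by linear_combination -e7
    rw [map_ofNat] at hxq
    -- For p = q = 2 the quadratic is x'² - x' + 2 = 0, of discriminant -7.
    apply h7 (2 * x' - 1)
    linear_combination 2 * hxq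

end QuadraticExtension

/-! ### Concrete subfields of ℂ -/

theorem exists_sq_of_finrank_eq_two {k L : Type*} [Field k] [Field L] [Algebra k L]
    (h2 : (2 : k) ≠ 0) (h : Module.finrank k L = 2) :
    ∃ (δ : L) (d : k), δ ^ 2 = algebraMap k L d ∧ δ ∉ Set.range (algebraMap k L) ∧
      ∀ z : L, ∃ a b : k, z = algebraMap k L a + algebraMap k L b * δ := by
  obtain ⟨θ, hθ⟩ : ∃ θ : L, θ ∉ Set.range (algebraMap k L) := by
    by_contra! hall
    have htop : (⊥ : Subalgebra k L) = ⊤ :=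
      eq_top_iff.2 fun z _ => Algebra.mem_bot.2 (hall z)
    rw [Subalgebra.bot_eq_top_iff_finrank_eq_one, h] at htop
    norm_num at htop
  have hli : LinearIndependent k ![1, θ] := by
    rw [LinearIndependent.pair_iff]
    intro a b hab
    have hb : b = 0 := by
      by_contra hb
      have hb' : algebraMap k L b ≠ 0 := by simpa using hb
      refine hθ ⟨-a / b, ?_⟩
      rw [map_div₀, map_neg]
      field_simp
      rw [Algebra.smul_def, Algebra.smul_def] at hab
      linear_combination -hab
    subst hb
    simpa [Algebra.smul_def] using hab
  have := Module.finite_of_finrank_eq_succ h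
  have hspan := hli.span_eq_top_of_card_eq_finrank' (by simp [h])
  have hrep (z : L) : ∃ a b : k, z = algebraMap k L a + algebraMap k L b * θ := by
    have hz : z ∈ Submodule.span k (Set.range ![1, θ]) := hspan ▸ Submodule.mem_top
    rw [Matrix.range_cons, Matrix.range_cons, Matrix.range_empty, Set.union_empty,
      Set.singleton_union, Submodule.mem_span_pair] at hz
    obtain ⟨a, b, rfl⟩ := hz
    exact ⟨a, b, by simp [Algebra.smul_def]⟩
  obtain ⟨e, f, hef⟩ := hrep (θ ^ 2)
  have h2' : (2 : L) ≠ 0 := by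
    rw [← map_ofNat (algebraMap k L)]
    exact (map_ne_zero (algebraMap k L)).2 h2
  refine ⟨θ - algebraMap k L (f / 2), e + (f / 2) ^ 2, ?_, ?_, fun z => ?_⟩
  · simp only [map_add, map_div₀, map_pow, map_ofNat]
    field_simp
    linear_combination 4 * hef
  · rintro ⟨c, hc⟩
    exact hθ ⟨c + f / 2, by rw [map_add, hc]; ring⟩
  · obtain ⟨a, b, rfl⟩ := hrep z
    refine ⟨a + b * (f / 2), b, ?_⟩
    simp only [map_add, map_mul]
    ring

theorem sqrtTwo_sq : sqrtTwo ^ 2 = 2 := by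
  unfold sqrtTwo
  rw [← Complex.ofReal_pow, Real.sq_sqrt (by norm_num)]
  norm_num

theorem exists_rat_of_mem_QSqrtTwo {z : ℂ} (hz : z ∈ QSqrtTwo) :
    ∃ a b : ℚ, z = a + b * sqrtTwo := by
  have halg : IsAlgebraic ℚ sqrtTwo :=
    (IsIntegral.of_pow two_pos (sqrtTwo_sq ▸ isIntegral_algebraMap (x := (2 : ℚ)))).isAlgebraic
  have hz' : z ∈ QSqrtTwo.toSubalgebra := hz
  rw [IntermediateField.adjoin_simple_toSubalgebra_of_isAlgebraic halg] at hz'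
  clear hz
  induction hz' using Algebra.adjoin_induction with
  | mem x hx => exact ⟨0, 1, by simp [Set.mem_singleton_iff.1 hx]⟩
  | algebraMap r => exact ⟨r, 0, by simp⟩
  | add x y _ _ hx hy =>
    obtain ⟨a, b, rfl⟩ := hx
    obtain ⟨c, e, rfl⟩ := hy
    exact ⟨a + c, b + e, by push_cast; ring⟩
  | mul x y _ _ hx hy =>
    obtain ⟨a, b, rfl⟩ := hx
    obtain ⟨c, e, rfl⟩ := hy
    refine ⟨a * c + 2 * b * e, a * e + b * c, ?_⟩
    push_cast
    linear_combination (b : ℂ) * e * sqrtTwo_sq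

theorem sqrtTwo_not_mem_range : sqrtTwo ∉ Set.range (algebraMap ℚ ℂ) := by
  rintro ⟨q, hq⟩
  refine rat_sq_ne_two q ?_
  have h : (q : ℂ) ^ 2 = 2 := by
    rw [← sqrtTwo_sq, ← hq, eq_ratCast]
  exact_mod_cast h

theorem im_eq_zero_of_mem_QSqrtTwo {z : ℂ} (hz : z ∈ QSqrtTwo) : z.im = 0 := by
  obtain ⟨a, b, rfl⟩ := exists_rat_of_mem_QSqrtTwo hz
  simp [sqrtTwo]

theorem not_mem_QSqrtTwo_of_sq_eq_neg {z : ℂ} {c : ℝ} (hc : 0 < c) (h : z ^ 2 = -(c : ℂ)) :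
    z ∉ QSqrtTwo := by
  intro hz
  have h1 : z = (z.re : ℂ) := Complex.ext rfl (by simpa using im_eq_zero_of_mem_QSqrtTwo hz)
  rw [h1] at h
  have h2 : z.re ^ 2 = -c := by exact_mod_cast h
  nlinarith [sq_nonneg z.re]

theorem not_mem_QSqrtTwo_of_sq_eq_mul {z : ℂ} {c : ℚ} (hc : c ≠ 0) (h : z ^ 2 = c * sqrtTwo) :
    z ∉ QSqrtTwo := by
  intro hz
  obtain ⟨a, b, rfl⟩ := exists_rat_of_mem_QSqrtTwo hz
  have h1 : algebraMap ℚ ℂ (a ^ 2 + 2 * b ^ 2) + algebraMap ℚ ℂ (2 * a * b - c) * sqrtTwo = 0 := by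
    simp only [eq_ratCast]
    push_cast
    linear_combination h - (b : ℂ) ^ 2 * sqrtTwo_sq
  have h2 : 2 * a * b - c = 0 := coeff_eq_zero sqrtTwo_not_mem_range ⟨0, by rw [h1, map_zero]⟩
  rw [h2, map_zero, zero_mul, add_zero, map_eq_zero] at h1
  have ha : a = 0 := by nlinarith [sq_nonneg a, sq_nonneg b]
  apply hc
  rw [ha] at h2
  linarith

theorem mem_of_sq_eq_sq {F : IntermediateField ℚ ℂ} {z w : ℂ} (hw : w ∈ F) (h : z ^ 2 = w ^ 2) :
    z ∈ F := by
  rcases sq_eq_sq_iff_eq_or_eq_neg.1 h with rfl | rfl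
  · exact hw
  · exact neg_mem hw

/-- A quadratic extension of `ℚ(√2)` lies in every field that contains `ℚ(√2)` and one of its
elements outside `ℚ(√2)`. -/
theorem toSubfield_le {K : IntermediateField QSqrtTwo ℂ} (hK : Module.finrank QSqrtTwo K = 2)
    {F : IntermediateField ℚ ℂ} (hF : sqrtTwo ∈ F) {θ : ℂ} (hθK : θ ∈ K) (hθF : θ ∈ F)
    (hθ : θ ∉ QSqrtTwo) : K.toSubfield ≤ F.toSubfield := by
  have hle (a : QSqrtTwo) : (a : ℂ) ∈ F :=
    (IntermediateField.adjoin_le_iff.2 (Set.singleton_subset_iff.2 hF)) a.2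
  obtain ⟨δ, d, -, -, hrep⟩ := exists_sq_of_finrank_eq_two two_ne_zero hK
  have hrep' {z : ℂ} (hz : z ∈ K) : ∃ a b : QSqrtTwo, z = a + b * (δ : ℂ) := by
    obtain ⟨a, b, hab⟩ := hrep ⟨z, hz⟩
    exact ⟨a, b, congrArg Subtype.val hab⟩
  have hδ : (δ : ℂ) ∈ F := by
    obtain ⟨a, b, hab⟩ := hrep' hθK
    have hb : (b : ℂ) ≠ 0 := by
      intro hb
      rw [hb, zero_mul, add_zero] at hab
      exact hθ (hab ▸ a.2)
    have : (δ : ℂ) = (θ - a) / b := by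
      rw [hab]; field_simp; ring
    rw [this]
    exact div_mem (sub_mem hθF (hle a)) (hle b)
  intro z hz
  obtain ⟨a, b, rfl⟩ := hrep' hz
  exact add_mem (hle a) (mul_mem (hle b) hδ)

theorem LiesIn.mono {P : ℙ ℂ (Fin 3 → ℂ)} {F G : Subfield ℂ} (h : LiesIn P F) (hFG : F ≤ G) :
    LiesIn P G := by
  obtain ⟨v, hv, hvF, hP⟩ := h
  exact ⟨v, hv, fun i => hFG (hvF i), hP⟩

theorem fourthRootTwo_sq : fourthRootTwo ^ 2 = sqrtTwo := by
  unfold fourthRootTwo sqrtTwo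
  rw [← Complex.ofReal_pow, ← Real.rpow_natCast, ← Real.rpow_mul (by norm_num),
    Real.sqrt_eq_rpow]
  norm_num

theorem sqrtNegSeven_sq : sqrtNegSeven ^ 2 = -7 := by
  unfold sqrtNegSeven
  rw [mul_pow, ← Complex.ofReal_pow, Real.sq_sqrt (by norm_num), Complex.I_sq]
  norm_num

/-- A point over a quadratic extension `K` of `ℚ(√2)` is defined over `ℚ(√2)` unless `K` contains
a square root of `-1`, `-7`, `√2` or `-√2`. -/
theorem liesIn_QSqrtTwo {K : IntermediateField QSqrtTwo ℂ} (hK : Module.finrank QSqrtTwo K = 2)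
    {P : ℙ ℂ (Fin 3 → ℂ)} (hP : P ∈ curve) (hPK : LiesIn P K.toSubfield)
    (hI : ∀ θ ∈ K, θ ^ 2 ≠ -1) (h7 : ∀ θ ∈ K, θ ^ 2 ≠ -7)
    (hr : ∀ θ ∈ K, θ ^ 2 ≠ sqrtTwo) (hr' : ∀ θ ∈ K, θ ^ 2 ≠ -sqrtTwo) :
    LiesIn P QSqrtTwo.toSubfield := by
  obtain ⟨v, hv, hvK, rfl⟩ := hPK
  rw [mk_mem_curve] at hP
  replace hvK (i : Fin 3) : v i ∈ K := hvK i
  have hv2 : v 2 ≠ 0 := by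
    intro hv2
    have hv1 : v 1 ≠ 0 := by
      intro hv1
      have hv0 : v 0 = 0 := by simpa [hv1, hv2] using hP
      apply hv
      ext i
      fin_cases i <;> assumption
    -- At infinity (v₀/v₁)⁴ = -1, so (v₀/v₁)² is a square root of -1 in K.
    refine hI _ (pow_mem (div_mem (hvK 0) (hvK 1)) 2) ?_
    rw [hv2] at hP
    field_simp
    linear_combination hP
  obtain ⟨δ, d, hδ, hind, hrep⟩ := exists_sq_of_finrank_eq_two two_ne_zero hK
  have hs : sqrtTwo ∈ QSqrtTwo := IntermediateField.mem_adjoin_simple_self ℚ _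
  have hs2 : (⟨sqrtTwo, hs⟩ : QSqrtTwo) ^ 2 = 2 := Subtype.ext sqrtTwo_sq
  have hk (X Y : QSqrtTwo) (h : Y ^ 2 = X ^ 3 + 4 * X) : X = 0 ∨ X = 2 := by
    refine eq_zero_or_eq_two hs2 (fun z => ?_) h
    obtain ⟨a, b, hab⟩ := exists_rat_of_mem_QSqrtTwo z.2
    exact ⟨a, b, Subtype.ext (by simpa using hab)⟩
  have h3 (u : QSqrtTwo) : u ^ 2 ≠ -3 := by
    intro hu
    refine not_mem_QSqrtTwo_of_sq_eq_neg (c := 3) (by norm_num) ?_ u.2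
    exact (congrArg Subtype.val hu).trans (by push_cast; rfl)
  have mem_k {x y : K} (h : x ^ 4 + y ^ 4 = 1) : (x : ℂ) ∈ QSqrtTwo := by
    obtain ⟨a, ha⟩ := mem_range_of_pow_four_add_pow_four_eq_one hk two_ne_zero hs2 h3 hδ hind hrep
      (fun θ hθ => hI θ θ.2 (by simpa using congrArg Subtype.val hθ))
      (fun θ hθ => h7 θ θ.2 (congrArg Subtype.val hθ))
      (fun θ hθ => hr θ θ.2 (congrArg Subtype.val hθ))
      (fun θ hθ => hr' θ θ.2 (congrArg Subtype.val hθ)) h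
    rw [← ha]
    exact a.2
  have hxy : (v 0 / v 2) ^ 4 + (v 1 / v 2) ^ 4 = 1 := by
    field_simp
    exact hP
  have hx : v 0 / v 2 ∈ QSqrtTwo := mem_k (x := ⟨_, div_mem (hvK 0) (hvK 2)⟩)
    (y := ⟨_, div_mem (hvK 1) (hvK 2)⟩) (Subtype.ext hxy)
  have hy : v 1 / v 2 ∈ QSqrtTwo := mem_k (x := ⟨_, div_mem (hvK 1) (hvK 2)⟩)
    (y := ⟨_, div_mem (hvK 0) (hvK 2)⟩) (Subtype.ext ((add_comm _ _).trans hxy))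
  refine ⟨![v 0 / v 2, v 1 / v 2, 1], fun h => one_ne_zero (congrFun h 2), fun i => ?_, ?_⟩
  · fin_cases i
    · exact hx
    · exact hy
    · exact one_mem QSqrtTwo
  · rw [Projectivization.mk_eq_mk_iff']
    refine ⟨v 2, ?_⟩
    ext i
    fin_cases i <;> simp <;> field_simp

end FermatQuartic

/-! ### The four exceptional extensions -/

theorem mainTheorem10
    (K : IntermediateField FermatQuartic.QSqrtTwo ℂ)
    (hK : Module.finrank FermatQuartic.QSqrtTwo K = 2)
    (P : ℙ ℂ (Fin 3 → ℂ))
    (hP : P ∈ FermatQuartic.curve)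
    (hPK : FermatQuartic.LiesIn P K.toSubfield) :
    FermatQuartic.LiesIn P
        (IntermediateField.adjoin ℚ {FermatQuartic.sqrtTwo, Complex.I}).toSubfield ∨
      FermatQuartic.LiesIn P
        (IntermediateField.adjoin ℚ
          {FermatQuartic.sqrtTwo, FermatQuartic.sqrtNegSeven}).toSubfield ∨
      FermatQuartic.LiesIn P
        (IntermediateField.adjoin ℚ {FermatQuartic.fourthRootTwo}).toSubfield ∨
      FermatQuartic.LiesIn P
        (IntermediateField.adjoin ℚ {FermatQuartic.fourthRootTwo * Complex.I}).toSubfield := by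
  have key {F : IntermediateField ℚ ℂ} (hF : FermatQuartic.sqrtTwo ∈ F) {θ : ℂ} (hθK : θ ∈ K)
      (hθF : θ ∈ F) (hθ : θ ∉ FermatQuartic.QSqrtTwo) : FermatQuartic.LiesIn P F.toSubfield :=
    hPK.mono (FermatQuartic.toSubfield_le hK hF hθK hθF hθ)
  have mem {S : Set ℂ} {z : ℂ} (h : z ∈ S) : z ∈ IntermediateField.adjoin ℚ S :=
    IntermediateField.subset_adjoin ℚ S h
  have hI2 : (FermatQuartic.fourthRootTwo * Complex.I) ^ 2 = -FermatQuartic.sqrtTwo := by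
    rw [mul_pow, FermatQuartic.fourthRootTwo_sq, Complex.I_sq, mul_neg_one]
  by_cases hI : ∃ θ ∈ K, θ ^ 2 = -1
  · obtain ⟨θ, hθK, hθ⟩ := hI
    refine Or.inl (key (mem (by simp)) hθK ?_ ?_)
    · exact FermatQuartic.mem_of_sq_eq_sq (w := Complex.I) (mem (by simp)) (by rw [hθ, Complex.I_sq])
    · exact FermatQuartic.not_mem_QSqrtTwo_of_sq_eq_neg one_pos (by simpa using hθ)
  by_cases h7 : ∃ θ ∈ K, θ ^ 2 = -7
  · obtain ⟨θ, hθK, hθ⟩ := h7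
    refine Or.inr (Or.inl (key (mem (by simp)) hθK ?_ ?_))
    · exact FermatQuartic.mem_of_sq_eq_sq (w := FermatQuartic.sqrtNegSeven) (mem (by simp))
        (by rw [hθ, FermatQuartic.sqrtNegSeven_sq])
    · exact FermatQuartic.not_mem_QSqrtTwo_of_sq_eq_neg (c := 7) (by norm_num) (by simpa using hθ)
  by_cases hr : ∃ θ ∈ K, θ ^ 2 = FermatQuartic.sqrtTwo
  · obtain ⟨θ, hθK, hθ⟩ := hr
    refine Or.inr (Or.inr (Or.inl (key ?_ hθK ?_ ?_)))
    · rw [← FermatQuartic.fourthRootTwo_sq]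
      exact pow_mem (mem (Set.mem_singleton _)) 2
    · exact FermatQuartic.mem_of_sq_eq_sq (mem (Set.mem_singleton _))
        (by rw [hθ, FermatQuartic.fourthRootTwo_sq])
    · exact FermatQuartic.not_mem_QSqrtTwo_of_sq_eq_mul one_ne_zero (by simpa using hθ)
  by_cases hr' : ∃ θ ∈ K, θ ^ 2 = -FermatQuartic.sqrtTwo
  · obtain ⟨θ, hθK, hθ⟩ := hr'
    refine Or.inr (Or.inr (Or.inr (key ?_ hθK ?_ ?_)))
    · rw [← neg_neg FermatQuartic.sqrtTwo, ← hI2]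
      exact neg_mem (pow_mem (mem (Set.mem_singleton _)) 2)
    · exact FermatQuartic.mem_of_sq_eq_sq (mem (Set.mem_singleton _)) (by rw [hθ, hI2])
    · exact FermatQuartic.not_mem_QSqrtTwo_of_sq_eq_mul (c := -1) (by norm_num) (by simpa using hθ)
  push Not at hI h7 hr hr'
  refine Or.inl ((FermatQuartic.liesIn_QSqrtTwo hK hP hPK hI h7 hr hr').mono ?_)
  exact IntermediateField.adjoin_le_iff.2 (Set.singleton_subset_iff.2 (mem (by simp)))
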